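/- A function $f:(0,\infty)\to[0,\infty)$ is a Stieltjes function (SF) if $f(s)=\frac{a}{s}+b+\int_{(0,\infty)}\frac{\sigma(du)}{s+u}$ for all $s>0$, with constants $a,b\ge 0$ and a Borel measure $\sigma$ on $(0,\infty)$ such that $\int_{(0,\infty)}\frac{\sigma(du)}{1+u}<\infty$. A function $g:(0,\infty)\to\mathbb R$ is completely monotone if it is infinitely differentiable and $(-1)^n g^{(n)}\ge 0$ for $n=0,1,2,\dots$. A function $h:(0,\infty)\to\mathbb R$ is a complete Bernstein function (CBF) if it is nonnegative and infinitely differentiable, $(-1)^{n-1}h^{(n)}\ge 0$ for $n=1,2,3,\dots$, and there are a constant $b\ge 0$ and a completely monotone function $g$ such that $\frac{h(s)}{s}=b+\int_0^\infty e^{-st}g(t)\,dt$ for all $s>0$, the integral being convergent. Let $B>0$ and let $\hat\varphi:(0,\infty)\to[0,\infty)$ be a bounded Stieltjes function with $\lim_{s\to0+}\hat\varphi(s)=1$ which is not identically $1$ (as is the case, for example, when $\hat\varphi(s)\to0$ as $s\to\infty$). For $s>0$ put $$\hat M(s)=B^{-1}\hat\varphi(s)\,[1-\hat\varphi(s)]^{-1},\qquad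 \Psi(s)=B\,\frac{1-\hat\varphi(s)}{\hat\varphi(s)},\qquad \hat k(s)=\frac{\Psi(s)}{s}.$$ Then $0<\hat\varphi(s)<1$ for all $s>0$, so that these quantities and $s/\Psi(s)$ are well defined, and: 1. $\Psi(s)=1/\hat M(s)$ for all $s>0$, and $\Psi$ is a complete Bernstein function; 2. $\hat k(s)=B\,\dfrac{1-\hat\varphi(s)}{s\,\hat\varphi(s)}$ and $\hat k(s)\hat M(s)=1/s$ for all $s>0$, and $\hat k$ is a Stieltjes function; 3. $s\mapsto s/\Psi(s)$ is a complete Bernstein function. -/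

import Mathlib

open MeasureTheory Set

noncomputable section

/-- `f` restricted to `(0, ∞)` is a (non-negative) Stieltjes function:
`f s = a / s + b + ∫_{(0,∞)} σ(du) / (s + u)` with `a, b ≥ 0` and a Borel measure `σ` on `(0, ∞)`
such that `∫_{(0,∞)} σ(du) / (1 + u) < ∞`. Values of `f` outside `(0, ∞)` are irrelevant. -/
def IsStieltjesFun (f : ℝ → ℝ) : Prop :=
  ∃ a b : ℝ, 0 ≤ a ∧ 0 ≤ b ∧ ∃ σ : Measure ℝ,
    IntegrableOn (fun u : ℝ => 1 / (1 + u)) (Ioi 0) σ ∧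
    ∀ s : ℝ, 0 < s → f s = a / s + b + ∫ u in Ioi (0 : ℝ), 1 / (s + u) ∂σ

/-- `g` restricted to `(0, ∞)` is completely monotone: it is infinitely differentiable there and
`(-1)ⁿ g⁽ⁿ⁾ ≥ 0` for `n = 0, 1, 2, …`. -/
def IsCompletelyMonotoneFun (g : ℝ → ℝ) : Prop :=
  ContDiffOn ℝ ((⊤ : ℕ∞) : WithTop ℕ∞) g (Ioi 0) ∧
    ∀ n : ℕ, ∀ t : ℝ, 0 < t → 0 ≤ (-1 : ℝ) ^ n * iteratedDeriv n g t

/-- `h` restricted to `(0, ∞)` is a Bernstein function: it is non-negative, infinitely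
differentiable, and `(-1)ⁿ⁻¹ h⁽ⁿ⁾ ≥ 0` for `n = 1, 2, 3, …` (written with `n + 1` for `n`). -/
def IsBernsteinFun (h : ℝ → ℝ) : Prop :=
  (∀ s : ℝ, 0 < s → 0 ≤ h s) ∧
    ContDiffOn ℝ ((⊤ : ℕ∞) : WithTop ℕ∞) h (Ioi 0) ∧
    ∀ n : ℕ, ∀ s : ℝ, 0 < s → 0 ≤ (-1 : ℝ) ^ n * iteratedDeriv (n + 1) h s

/-- `h` restricted to `(0, ∞)` is a complete Bernstein function: it is a Bernstein function and
`h s / s` is the Laplace transform of a completely monotone function `g`, up to the non-negative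
drift constant `b` (the Laplace transform of a mass `b` at `0`), so that `h s = b * s` is
included. -/
def IsCompleteBernsteinFun (h : ℝ → ℝ) : Prop :=
  IsBernsteinFun h ∧
    ∃ b : ℝ, 0 ≤ b ∧ ∃ g : ℝ → ℝ, IsCompletelyMonotoneFun g ∧
      ∀ s : ℝ, 0 < s →
        IntegrableOn (fun t : ℝ => Real.exp (-(s * t)) * g t) (Ioi 0) volume ∧
        h s / s = b + ∫ t in Ioi (0 : ℝ), Real.exp (-(s * t)) * g t

/-- The memory function in the Laplace domain, `M̂ = B⁻¹ φ̂ [1 - φ̂]⁻¹`. -/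
def memoryM (B : ℝ) (φ : ℝ → ℝ) (s : ℝ) : ℝ := B⁻¹ * φ s * (1 - φ s)⁻¹

/-- The Laplace (Lévy) exponent `Ψ = B [1 - φ̂] / φ̂`. -/
def laplaceExponent (B : ℝ) (φ : ℝ → ℝ) (s : ℝ) : ℝ := B * (1 - φ s) / φ s

/-- The partner memory in the Laplace domain, `k̂(s) = Ψ(s) / s`. -/
def memoryK (B : ℝ) (φ : ℝ → ℝ) (s : ℝ) : ℝ := laplaceExponent B φ s / s

end

open Filter Topology

/-! Everything rests on one inversion theorem: if `f` is a positive Stieltjes function, so is `1 /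
(s f(s))` (`IsStieltjesFun.inv_mul`). Then `1 / (s φ)` is Stieltjes, and since `φ → 1` its pole at
`0` has coefficient exactly `1`; removing the pole leaves `k̂ = B (1 / (s φ) - 1 / s)`, still
Stieltjes. Multiplying a Stieltjes function by `s` gives a complete Bernstein function, which
settles `Ψ = s k̂`, and a second inversion settles `s / Ψ = s · 1 / (s k̂)`.

The substitution `t = 1 / (1 + u)` turns Stieltjes functions into the integrals `∫ (1 + (s - 1) t)⁻¹
dμ` with `μ` finite on `[0, 1]`; the terms `a / s` and `b` become atoms at `1` and `0`.

The inversion is operator-theoretic, without complex analysis. For `μ` a probability measure, `f(s)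
= ⟨v, (1 + (s - 1) R²)⁻¹ v⟩` in `L²(μ)`, where `R` multiplies by `√t` and `v = 1`. With `S = R (1 -
|v⟩⟨v|) R`, a Schur complement gives `1 / f(s) = 1 + (s - 1) ⟨R v, (1 + (s - 1) S)⁻¹ R v⟩`, and the
spectral measure `κ` of `S` at `R v` turns this into an integral over `[0, 1]`. Positivity as `s →
0` makes `(1 - x)⁻¹` integrable for `κ`, and partial fractions allow the division by `s`. -/

theorem min_le_one_add_mul {s t : ℝ} (ht : t ∈ Icc (0 : ℝ) 1) :
    min 1 s ≤ 1 + (s - 1) * t := by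
  obtain ⟨h0, h1⟩ := ht
  rcases le_total 1 s with h | h
  · rw [min_eq_left h]; nlinarith
  · rw [min_eq_right h]; nlinarith

theorem one_add_mul_pos {s t : ℝ} (hs : 0 < s) (ht : t ∈ Icc (0 : ℝ) 1) :
    0 < 1 + (s - 1) * t :=
  (lt_min one_pos hs).trans_le (min_le_one_add_mul ht)

theorem inv_one_add_mul_le {s t : ℝ} (hs : 0 < s) (ht : t ∈ Icc (0 : ℝ) 1) :
    (1 + (s - 1) * t)⁻¹ ≤ (min 1 s)⁻¹ :=
  inv_anti₀ (lt_min one_pos hs) (min_le_one_add_mul ht)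

/-! ### Spectral measures and the Schur complement -/

open scoped InnerProductSpace in
/-- The scalar spectral measure of a bounded self-adjoint operator at a vector. -/
theorem exists_scalar_spectral_measure {H : Type*} [NormedAddCommGroup H] [InnerProductSpace ℂ H]
    [CompleteSpace H] (S : H →L[ℂ] H) (hS : IsSelfAdjoint S) (w : H) :
    ∃ κ : Measure ℝ, IsFiniteMeasure κ ∧ (∀ᵐ x ∂κ, x ∈ spectrum ℝ S) ∧
      ∀ f : ℝ → ℝ, ContinuousOn f (spectrum ℝ S) →
        ∫ x, f x ∂κ = (⟪w, cfc f S w⟫_ℂ).re := by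
  have hcpt : IsCompact (spectrum ℝ S) := ContinuousFunctionalCalculus.isCompact_spectrum S
  have : CompactSpace (spectrum ℝ S) := isCompact_iff_compactSpace.mp hcpt
  -- Riesz–Markov for the positive functional `f ↦ Re ⟨w, f(S) w⟩`. The spectrum is compact, so
  -- compact support is no restriction.
  let Λ₀ : CompactlySupportedContinuousMap (spectrum ℝ S) ℝ →ₗ[ℝ] ℝ :=
    { toFun := fun f => (⟪w, cfcHom hS (f : C(spectrum ℝ S, ℝ)) w⟫_ℂ).re
      map_add' := by
        intro f g
        have : ((f + g : CompactlySupportedContinuousMap (spectrum ℝ S) ℝ) :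
          C(spectrum ℝ S, ℝ)) = (f : C(spectrum ℝ S, ℝ)) + (g : C(spectrum ℝ S, ℝ)) := rfl
        rw [this, map_add]
        simp
      map_smul' := by
        intro c f
        have : ((c • f : CompactlySupportedContinuousMap (spectrum ℝ S) ℝ) :
          C(spectrum ℝ S, ℝ)) = c • (f : C(spectrum ℝ S, ℝ)) := rfl
        rw [this, map_smul]
        simp [inner_smul_right_eq_smul] }
  let Λ : CompactlySupportedContinuousMap (spectrum ℝ S) ℝ →ₚ[ℝ] ℝ :=
    PositiveLinearMap.mk₀ Λ₀ (by
      intro f hf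
      have h0 : 0 ≤ cfcHom hS (f : C(spectrum ℝ S, ℝ)) :=
        (cfcHom_nonneg_iff hS).2 fun x => hf x
      have h1 := ((ContinuousLinearMap.nonneg_iff_isPositive _).1 h0).re_inner_nonneg_right w
      exact h1)
  have hΛ : ∀ f, ∫ x, f x ∂(RealRMK.rieszMeasure Λ) = Λ f := RealRMK.integral_rieszMeasure Λ
  have hme : MeasurableEmbedding (Subtype.val : spectrum ℝ S → ℝ) :=
    MeasurableEmbedding.subtype_coe hcpt.measurableSet
  have : IsFiniteMeasure (RealRMK.rieszMeasure Λ) := by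
    constructor
    refine (RealRMK.rieszMeasure_le_of_eq_one Λ (K := Set.univ)
      (f := CompactlySupportedContinuousMap.continuousMapEquiv 1) (fun _ => zero_le_one)
      isCompact_univ (fun _ _ => rfl)).trans_lt ENNReal.ofReal_lt_top
  refine ⟨(RealRMK.rieszMeasure Λ).map Subtype.val, inferInstance, ?_, ?_⟩
  · rw [hme.ae_map_iff]
    exact Filter.Eventually.of_forall fun x => x.2
  · intro f hf
    rw [hme.integral_map, cfc_apply f S hS hf]
    exact hΛ (CompactlySupportedContinuousMap.continuousMapEquiv ⟨_, hf.domRestrict⟩)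

open scoped InnerProductSpace in
/-- A Schur complement identity for the resolvents of `R ^ 2` and `R (1 - |v⟩⟨v|) R`. -/
theorem exists_measure_inv_resolvent {H : Type*} [NormedAddCommGroup H] [InnerProductSpace ℂ H]
    [CompleteSpace H] (R : H →L[ℂ] H) (hR : IsSelfAdjoint R) (hR1 : ‖R‖ ≤ 1) (v : H)
    (hv : ‖v‖ = 1) :
    ∃ κ : Measure ℝ, IsFiniteMeasure κ ∧ (∀ᵐ x ∂κ, x ∈ Icc (0 : ℝ) 1) ∧
      ∀ s : ℝ, 0 < s → ∀ y : H, y + ((s - 1 : ℝ) : ℂ) • R (R y) = v → ∀ c : ℝ, c ≠ 0 →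
        ⟪v, y⟫_ℂ = c → c⁻¹ = 1 + (s - 1) * ∫ x, (1 + (s - 1) * x)⁻¹ ∂κ := by
  have hRs : ∀ a b, ⟪R a, b⟫_ℂ = ⟪a, R b⟫_ℂ := fun a b => hR.isSymmetric a b
  have hvv : ⟪v, v⟫_ℂ = 1 := by rw [inner_self_eq_norm_sq_to_K, hv]; simp
  let P : H →L[ℂ] H := InnerProductSpace.rankOne ℂ v v
  have hP : ∀ a, P a = ⟪v, a⟫_ℂ • v := fun a => by simp [P]
  -- `S = R² - |R v⟩⟨R v|`; the factored form gives `0 ≤ S ≤ 1` because `1 - P` is a projection.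
  let S : H →L[ℂ] H := R ∘L (1 - P) ∘L R
  have hSa : ∀ a, S a = R (R a) - ⟪v, R a⟫_ℂ • R v := fun a => by simp [S, hP]
  have hSpos : S.IsPositive := by
    rw [ContinuousLinearMap.isPositive_iff_complex]
    intro a
    have h1 : ⟪S a, a⟫_ℂ = ((‖R a‖ ^ 2 - ‖⟪v, R a⟫_ℂ‖ ^ 2 : ℝ) : ℂ) := by
      rw [hSa, inner_sub_left, inner_smul_left, hRs, inner_self_eq_norm_sq_to_K, hRs,
        RCLike.conj_mul]
      push_cast
      rfl
    have h2 : ‖⟪v, R a⟫_ℂ‖ ≤ ‖R a‖ := by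
      simpa [hv] using norm_inner_le_norm (𝕜 := ℂ) v (R a)
    rw [h1]
    refine ⟨rfl, ?_⟩
    have := pow_le_pow_left₀ (norm_nonneg _) h2 2
    simp only [RCLike.re_to_complex, Complex.ofReal_re]
    linarith
  have hSsa : IsSelfAdjoint S := hSpos.isSelfAdjoint
  have hSnorm : ‖S‖ ≤ 1 := by
    refine ContinuousLinearMap.opNorm_le_bound _ zero_le_one fun a => ?_
    have hQ : ∀ b, ‖b - ⟪v, b⟫_ℂ • v‖ ≤ ‖b‖ := by
      intro b
      have h3 : ‖b - ⟪v, b⟫_ℂ • v‖ ^ 2 = ‖b‖ ^ 2 - ‖⟪v, b⟫_ℂ‖ ^ 2 := by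
        rw [@norm_sub_sq ℂ, inner_smul_right, norm_smul, hv, ← inner_conj_symm b v,
          RCLike.mul_conj]
        norm_cast
        simp
        ring
      exact le_of_sq_le_sq (by rw [h3]; nlinarith [sq_nonneg ‖⟪v, b⟫_ℂ‖]) (norm_nonneg _)
    have h4 : S a = R (R a - ⟪v, R a⟫_ℂ • v) := by rw [hSa]; simp
    have hR' : ∀ b, ‖R b‖ ≤ ‖b‖ := fun b =>
      (R.le_of_opNorm_le hR1 b).trans (by simp)
    rw [h4, one_mul]
    exact ((hR' _).trans (hQ _)).trans (hR' _)
  have hspec : spectrum ℝ S ⊆ Icc 0 1 := by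
    intro x hx
    have : Nontrivial H := ⟨v, 0, by rintro rfl; simp at hv⟩
    refine ⟨spectrum_nonneg_of_nonneg ((ContinuousLinearMap.nonneg_iff_isPositive S).2 hSpos) hx,
      ?_⟩
    exact (Real.le_norm_self x).trans ((spectrum.norm_le_norm_of_mem hx).trans hSnorm)
  obtain ⟨κ, hfin, hκ, hint⟩ := exists_scalar_spectral_measure S hSsa (R v)
  refine ⟨κ, hfin, hκ.mono fun x hx => hspec hx, ?_⟩
  intro s hs y hy c hc hvy
  have hne : ∀ x ∈ spectrum ℝ S, 1 + (s - 1) * x ≠ 0 := by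
    exact fun x hx => (one_add_mul_pos hs (hspec hx)).ne'
  have hcont : ContinuousOn (fun x : ℝ => (1 + (s - 1) * x)⁻¹) (spectrum ℝ S) :=
    ContinuousOn.inv₀ (by fun_prop) hne
  have hmul : cfc (fun x : ℝ => (1 + (s - 1) * x)⁻¹) S * (1 + (s - 1 : ℝ) • S) = 1 := by
    have h5 : cfc (fun x : ℝ => 1 + (s - 1) * x) S = 1 + (s - 1 : ℝ) • S := by
      rw [cfc_const_add 1 _ S, cfc_const_mul _ _ S, cfc_id' ℝ S]
      simp
    rw [← h5, ← cfc_mul _ _ S hcont (by fun_prop), ← cfc_one ℝ S]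
    exact cfc_congr fun x hx => by simp [inv_mul_cancel₀ (hne x hx)]
  -- The equation for `y`, paired with `v`.
  have hRRy : ((s - 1 : ℝ) : ℂ) * ⟪v, R (R y)⟫_ℂ = 1 - c := by
    have := congrArg (fun z => ⟪v, z⟫_ℂ) hy
    simp only [inner_add_right, inner_smul_right, hvy, hvv] at this
    rw [← this]; ring
  -- Applying `R` to the equation for `y` and trading `R²` for `S` costs `(1 - c) • R v`, by `hRRy`.
  -- Inverting `1 + (s - 1) S` then expresses `R y` through `R v`.
  have hRy : (1 + (s - 1 : ℝ) • S) (R y) = (c : ℂ) • R v := by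
    have h6 : (1 + (s - 1 : ℝ) • S) (R y) =
        R (y + ((s - 1 : ℝ) : ℂ) • R (R y)) - (((s - 1 : ℝ) : ℂ) * ⟪v, R (R y)⟫_ℂ) • R v := by
      have : (1 + (s - 1 : ℝ) • S) (R y) = R y + ((s - 1 : ℝ) : ℂ) • S (R y) := by
        rw [Complex.coe_smul]; rfl
      rw [this, hSa, map_add, map_smul, smul_sub, smul_smul]
      abel
    rw [h6, hy, hRRy, sub_smul, one_smul]
    abel
  have hcfc : R y = (c : ℂ) • cfc (fun x : ℝ => (1 + (s - 1) * x)⁻¹) S (R v) := by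
    rw [← map_smul, ← hRy, ← mul_apply_eq_comp, hmul, one_apply_eq_self]
  have hfinal : ((s - 1 : ℝ) : ℂ) * ((c : ℂ) *
      ⟪R v, cfc (fun x : ℝ => (1 + (s - 1) * x)⁻¹) S (R v)⟫_ℂ) = 1 - c := by
    rw [← inner_smul_right, ← hcfc, hRs, hRRy]
  have hre := congrArg Complex.re hfinal
  rw [Complex.re_ofReal_mul, Complex.re_ofReal_mul, ← hint _ hcont] at hre
  simp only [Complex.sub_re, Complex.one_re, Complex.ofReal_re] at hre
  field_simp
  simp only [one_div]
  linarith

theorem integrable_inv_one_add_mul {μ : Measure ℝ} [IsFiniteMeasure μ]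
    (hμ : ∀ᵐ t ∂μ, t ∈ Icc (0 : ℝ) 1) {s : ℝ} (hs : 0 < s) :
    Integrable (fun t => (1 + (s - 1) * t)⁻¹) μ := by
  refine Integrable.of_bound (by fun_prop) (min 1 s)⁻¹ (hμ.mono fun t ht => ?_)
  rw [Real.norm_of_nonneg (inv_nonneg.2 (one_add_mul_pos hs ht).le)]
  exact inv_one_add_mul_le hs ht

open scoped InnerProductSpace ENNReal in
/-- The reciprocal of `s ↦ ∫ (1 + (s - 1) t)⁻¹ dμ(t)`, for a probability measure on `[0, 1]`. -/
theorem exists_measure_inv_integral (μ : Measure ℝ) [IsProbabilityMeasure μ]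
    (hμ : ∀ᵐ t ∂μ, t ∈ Icc (0 : ℝ) 1) :
    ∃ κ : Measure ℝ, IsFiniteMeasure κ ∧ (∀ᵐ x ∂κ, x ∈ Icc (0 : ℝ) 1) ∧
      ∀ s : ℝ, 0 < s → ∫ t, (1 + (s - 1) * t)⁻¹ ∂μ ≠ 0 →
        (∫ t, (1 + (s - 1) * t)⁻¹ ∂μ)⁻¹ = 1 + (s - 1) * ∫ x, (1 + (s - 1) * x)⁻¹ ∂κ := by
  have hbd : ∀ᵐ t ∂μ, ‖((√t : ℝ) : ℂ)‖ ≤ 1 := hμ.mono fun t ht => by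
    rw [Complex.norm_real, Real.norm_of_nonneg (Real.sqrt_nonneg t)]
    exact Real.sqrt_le_one.2 ht.2
  have hmem : MemLp (fun t : ℝ => ((√t : ℝ) : ℂ)) ∞ μ :=
    memLp_top_of_bound (by fun_prop) 1 hbd
  let r : Lp ℂ ∞ μ := hmem.toLp
  have hr : ‖r‖ ≤ 1 := by
    rw [Lp.norm_toLp]
    refine ENNReal.toReal_le_of_le_ofReal zero_le_one ?_
    rw [eLpNorm_exponent_top]
    exact eLpNormEssSup_le_of_ae_bound hbd
  -- Multiplication by `√t`, so that `R²` is multiplication by `t`; the vector `y` below is the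
  -- function `(1 + (s - 1) t)⁻¹`.
  let R : Lp ℂ 2 μ →L[ℂ] Lp ℂ 2 μ := LinearMap.mkContinuous
    { toFun := fun g => (r • g : Lp ℂ 2 μ)
      map_add' := fun f g => Lp.add_smul r f g
      map_smul' := fun c g => (Lp.smul_comm c r g).symm } 1
    fun g => (Lp.norm_smul_le r g).trans (mul_le_mul_of_nonneg_right hr (norm_nonneg g))
  have hRae : ∀ g : Lp ℂ 2 μ, R g =ᵐ[μ] fun t => ((√t : ℝ) : ℂ) * g t := by
    intro g
    have h1 : R g =ᵐ[μ] fun t => r t • g t := Lp.coeFn_lpSMul r g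
    filter_upwards [h1, hmem.coeFn_toLp] with t h2 h3
    rw [h2, h3, smul_eq_mul]
  have hRsa : IsSelfAdjoint R := by
    rw [ContinuousLinearMap.isSelfAdjoint_iff_isSymmetric]
    intro f g
    change ⟪R f, g⟫_ℂ = ⟪f, R g⟫_ℂ
    rw [L2.inner_def, L2.inner_def]
    refine integral_congr_ae ?_
    filter_upwards [hRae f, hRae g] with t h1 h2
    rw [h1, h2]
    simp
    ring
  have hv : ‖(Lp.const 2 μ (1 : ℂ))‖ = 1 := by
    have h := Lp.norm_const (μ := μ) (p := 2) (c := (1 : ℂ)) (by simp)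
    simpa using h
  obtain ⟨κ, hfin, hκ, hint⟩ := exists_measure_inv_resolvent R hRsa
    (LinearMap.mkContinuous_norm_le _ zero_le_one _) (Lp.const 2 μ (1 : ℂ)) hv
  refine ⟨κ, hfin, hκ, fun s hs hne => ?_⟩
  have hymem : MemLp (fun t : ℝ => (((1 + (s - 1) * t)⁻¹ : ℝ) : ℂ)) 2 μ := by
    refine MemLp.of_bound (by fun_prop) (min 1 s)⁻¹ (hμ.mono fun t ht => ?_)
    rw [Complex.norm_real, Real.norm_of_nonneg (inv_nonneg.2 (one_add_mul_pos hs ht).le)]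
    exact inv_one_add_mul_le hs ht
  refine hint s hs hymem.toLp ?_ _ hne ?_
  · refine Lp.ext ?_
    filter_upwards [Lp.coeFn_add hymem.toLp (((s - 1 : ℝ) : ℂ) • R (R hymem.toLp)),
      Lp.coeFn_smul ((s - 1 : ℝ) : ℂ) (R (R hymem.toLp)), hRae (R hymem.toLp),
      hRae hymem.toLp, hymem.coeFn_toLp, Lp.coeFn_const 2 μ (1 : ℂ), hμ]
      with t h1 h2 h3 h4 h5 h6 ht
    rw [h1, Pi.add_apply, h2, Pi.smul_apply, h3, h4, h5, h6, smul_eq_mul, Function.const_apply]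
    norm_cast
    rw [← mul_assoc √t, Real.mul_self_sqrt ht.1]
    have := (one_add_mul_pos hs ht).ne'
    field_simp
  · rw [L2.inner_def, ← integral_complex_ofReal]
    refine integral_congr_ae ?_
    filter_upwards [hymem.coeFn_toLp, Lp.coeFn_const 2 μ (1 : ℂ)] with t h1 h2
    rw [h1, h2]
    simp

/-! ### Stieltjes functions as integrals over `[0, 1]` -/

theorem IsStieltjesFun.congr {f g : ℝ → ℝ} (hf : IsStieltjesFun f)
    (h : ∀ s : ℝ, 0 < s → g s = f s) : IsStieltjesFun g := by
  obtain ⟨a, b, ha, hb, σ, hσ, hrep⟩ := hf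
  exact ⟨a, b, ha, hb, σ, hσ, fun s hs => (h s hs).trans (hrep s hs)⟩

theorem IsStieltjesFun.const_mul {f : ℝ → ℝ} (hf : IsStieltjesFun f) {c : ℝ} (hc : 0 ≤ c) :
    IsStieltjesFun (fun s => c * f s) := by
  obtain ⟨a, b, ha, hb, σ, hσ, hrep⟩ := hf
  refine ⟨c * a, c * b, mul_nonneg hc ha, mul_nonneg hc hb, ENNReal.ofReal c • σ, ?_, ?_⟩
  · rw [IntegrableOn, Measure.restrict_smul]
    exact hσ.smul_measure ENNReal.ofReal_ne_top
  · intro s hs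
    simp only
    rw [Measure.restrict_smul, integral_smul_measure, hrep s hs, ENNReal.toReal_ofReal hc,
      smul_eq_mul]
    ring

/-- With `t = (1 + u)⁻¹` one has `1 / (s + u) = (1 + u)⁻¹ (1 + (s - 1) t)⁻¹`. The weight `(1 + u)⁻¹`
makes the measure finite; `a` and `b` become atoms at `1` and `0`, where the kernel is `1 / s` and
`1`. -/
theorem IsStieltjesFun.exists_measure_Icc {f : ℝ → ℝ} (hf : IsStieltjesFun f) :
    ∃ μ : Measure ℝ, IsFiniteMeasure μ ∧ (∀ᵐ t ∂μ, t ∈ Icc (0 : ℝ) 1) ∧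
      ∀ s : ℝ, 0 < s → f s = ∫ t, (1 + (s - 1) * t)⁻¹ ∂μ := by
  obtain ⟨a, b, ha, hb, σ, hσ, hrep⟩ := hf
  let ρ : Measure ℝ := (σ.restrict (Ioi 0)).withDensity fun u => ENNReal.ofReal (1 / (1 + u))
  have hρ : IsFiniteMeasure ρ := isFiniteMeasure_withDensity_ofReal hσ.2
  have hpos : ∀ᵐ u ∂(σ.restrict (Ioi 0)), 0 < u := ae_restrict_mem measurableSet_Ioi
  have hm : Measurable fun u : ℝ => (1 + u)⁻¹ := by fun_prop
  have h1 : ∀ᵐ t ∂(ENNReal.ofReal a • Measure.dirac (1 : ℝ)), t ∈ Icc (0 : ℝ) 1 :=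
    Measure.ae_smul_measure ((ae_dirac_iff measurableSet_Icc).2 (by simp)) _
  have h2 : ∀ᵐ t ∂(ENNReal.ofReal b • Measure.dirac (0 : ℝ)), t ∈ Icc (0 : ℝ) 1 :=
    Measure.ae_smul_measure ((ae_dirac_iff measurableSet_Icc).2 (by simp)) _
  have h3 : ∀ᵐ t ∂(ρ.map fun u => (1 + u)⁻¹), t ∈ Icc (0 : ℝ) 1 := by
    refine (ae_map_iff hm.aemeasurable measurableSet_Icc).2 ?_
    refine (withDensity_absolutelyContinuous _ _).ae_le (hpos.mono fun u hu => ?_)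
    exact ⟨by positivity, inv_le_one_of_one_le₀ (by linarith)⟩
  have hfa : IsFiniteMeasure (ENNReal.ofReal a • Measure.dirac (1 : ℝ)) :=
    Measure.smul_finite _ ENNReal.ofReal_ne_top
  have hfb : IsFiniteMeasure (ENNReal.ofReal b • Measure.dirac (0 : ℝ)) :=
    Measure.smul_finite _ ENNReal.ofReal_ne_top
  refine ⟨ENNReal.ofReal a • Measure.dirac 1 + ENNReal.ofReal b • Measure.dirac 0 +
    ρ.map fun u => (1 + u)⁻¹, inferInstance, ?_, fun s hs => ?_⟩
  · rw [ae_add_measure_iff, ae_add_measure_iff]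
    exact ⟨⟨h1, h2⟩, h3⟩
  · rw [integral_add_measure ((integrable_inv_one_add_mul h1 hs).add_measure
      (integrable_inv_one_add_mul h2 hs)) (integrable_inv_one_add_mul h3 hs),
      integral_add_measure (integrable_inv_one_add_mul h1 hs) (integrable_inv_one_add_mul h2 hs),
      integral_smul_measure, integral_smul_measure, integral_dirac, integral_dirac,
      integral_map hm.aemeasurable (by fun_prop),
      integral_withDensity_eq_integral_toReal_smul (by fun_prop) (by simp), hrep s hs,
      ENNReal.toReal_ofReal ha, ENNReal.toReal_ofReal hb]
    congr 1
    · simp [div_eq_mul_inv]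
    · refine integral_congr_ae (hpos.mono fun u hu => ?_)
      simp only
      rw [ENNReal.toReal_ofReal (by positivity), smul_eq_mul]
      have : 1 + (s - 1) * (1 + u)⁻¹ = (s + u) / (1 + u) := by field_simp; ring
      rw [this]
      field_simp

/-- The inverse substitution `u = t⁻¹ - 1` on `(0, 1)`, with density `t⁻¹`; the atoms at `1` and `0`
give back `a` and `b`. -/
theorem isStieltjesFun_of_measure_Icc {f : ℝ → ℝ} (μ : Measure ℝ) [IsFiniteMeasure μ]
    (hμ : ∀ᵐ t ∂μ, t ∈ Icc (0 : ℝ) 1)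
    (hf : ∀ s : ℝ, 0 < s → f s = ∫ t, (1 + (s - 1) * t)⁻¹ ∂μ) : IsStieltjesFun f := by
  have hmem : ∀ᵐ t ∂(μ.restrict (Ioo 0 1)), t ∈ Ioo (0 : ℝ) 1 := ae_restrict_mem measurableSet_Ioo
  have hm : Measurable fun t : ℝ => t⁻¹ - 1 := by fun_prop
  let ρ : Measure ℝ := (μ.restrict (Ioo 0 1)).withDensity fun t => ENNReal.ofReal t⁻¹
  have hσ : (ρ.map fun t => t⁻¹ - 1).restrict (Ioi 0) = ρ.map fun t => t⁻¹ - 1 := by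
    refine Measure.restrict_eq_self_of_ae_mem ?_
    refine (ae_map_iff hm.aemeasurable measurableSet_Ioi).2 ?_
    refine (withDensity_absolutelyContinuous _ _).ae_le (hmem.mono fun t ht => ?_)
    have := (one_lt_inv₀ ht.1).2 ht.2
    exact sub_pos.2 this
  have hker : ∀ s : ℝ, 0 < s → ∀ t ∈ Ioo (0 : ℝ) 1,
      (ENNReal.ofReal t⁻¹).toReal • (1 / (s + (t⁻¹ - 1))) = (1 + (s - 1) * t)⁻¹ := by
    intro s hs t ht
    have h0 := ht.1
    have h1 := one_add_mul_pos hs (Ioo_subset_Icc_self ht)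
    rw [ENNReal.toReal_ofReal (by positivity), smul_eq_mul]
    have : s + (t⁻¹ - 1) = (1 + (s - 1) * t) / t := by field_simp; ring
    rw [this]
    field_simp
  have hint : ∀ s : ℝ, 0 < s → IntegrableOn (fun t => (1 + (s - 1) * t)⁻¹) (Ioo 0 1) μ :=
    fun s hs => (integrable_inv_one_add_mul hμ hs).integrableOn
  refine ⟨μ.real {1}, μ.real {0}, measureReal_nonneg, measureReal_nonneg,
    ρ.map fun t => t⁻¹ - 1, ?_, fun s hs => ?_⟩
  · rw [IntegrableOn, hσ, integrable_map_measure
      (by exact (Measurable.aestronglyMeasurable (by fun_prop))) hm.aemeasurable,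
      integrable_withDensity_iff_integrable_smul' (by fun_prop) (by simp)]
    -- The integrability condition on `σ` concerns the kernel at `s = 1`, which is the constant `1`
    -- in the variable `t`.
    exact (hint 1 one_pos).congr (hmem.mono fun t ht => (hker 1 one_pos t ht).symm)
  · have hIcc : μ.restrict (Icc 0 1) = μ := Measure.restrict_eq_self_of_ae_mem hμ
    have hi := (integrable_inv_one_add_mul hμ hs)
    rw [hσ, integral_map hm.aemeasurable
      (by exact (Measurable.aestronglyMeasurable (by fun_prop))),
      integral_withDensity_eq_integral_toReal_smul (by fun_prop) (by simp), hf s hs,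
      setIntegral_congr_fun measurableSet_Ioo (hker s hs)]
    conv_lhs => rw [← hIcc, ← Ioo_union_both zero_le_one]
    rw [setIntegral_union (by simp) (by measurability) hi.integrableOn hi.integrableOn,
      insert_eq, setIntegral_union (by simp) (by measurability) hi.integrableOn hi.integrableOn,
      integral_singleton, integral_singleton]
    simp [div_eq_mul_inv]
    ring

/-! ### The inversion `f ↦ 1 / (s f(s))` -/

/-- Fatou's lemma as `s → 0`. The inverse is taken in `ENNReal`, so it is `∞` at `x = 1` and the
bound also excludes an atom there. -/
theorem lintegral_inv_one_sub_le {κ : Measure ℝ} [IsFiniteMeasure κ]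
    (hκ : ∀ᵐ t ∂κ, t ∈ Icc (0 : ℝ) 1)
    (h : ∀ s : ℝ, 0 < s → s < 1 → (1 - s) * ∫ x, (1 + (s - 1) * x)⁻¹ ∂κ ≤ 1) :
    ∫⁻ x, (ENNReal.ofReal (1 - x))⁻¹ ∂κ ≤ 1 := by
  -- The shift by `2` keeps `s n < 1` even for `n = 0`.
  let s : ℕ → ℝ := fun n => 1 / ((n : ℝ) + 2)
  have hs0 : ∀ n, 0 < s n := fun n => by positivity
  have hs1 : ∀ n, s n < 1 := fun n => by
    rw [div_lt_one (by positivity)]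
    have : (0 : ℝ) ≤ n := n.cast_nonneg
    linarith
  have hs : Tendsto s atTop (𝓝 0) := by
    refine Tendsto.div_atTop tendsto_const_nhds ?_
    exact tendsto_atTop_add_const_right _ _ tendsto_natCast_atTop_atTop
  have hlim : ∀ x, Tendsto (fun n => (ENNReal.ofReal (1 + (s n - 1) * x))⁻¹) atTop
      (𝓝 (ENNReal.ofReal (1 - x))⁻¹) := by
    intro x
    refine tendsto_inv_iff.2 (ENNReal.tendsto_ofReal ?_)
    have := ((hs.sub_const 1).mul_const x).const_add 1
    convert this using 2
    ring
  have hle : ∀ n, ∫⁻ x, (ENNReal.ofReal (1 + (s n - 1) * x))⁻¹ ∂κ ≤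
      ENNReal.ofReal (1 / (1 - s n)) := by
    intro n
    have h1 : ∫⁻ x, (ENNReal.ofReal (1 + (s n - 1) * x))⁻¹ ∂κ =
        ∫⁻ x, ENNReal.ofReal (1 + (s n - 1) * x)⁻¹ ∂κ :=
      lintegral_congr_ae (hκ.mono fun x hx =>
        (ENNReal.ofReal_inv_of_pos (one_add_mul_pos (hs0 n) hx)).symm)
    rw [h1, ← ofReal_integral_eq_lintegral_ofReal (integrable_inv_one_add_mul hκ (hs0 n))
      (hκ.mono fun x hx => inv_nonneg.2 (one_add_mul_pos (hs0 n) hx).le)]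
    refine ENNReal.ofReal_le_ofReal ?_
    rw [le_div_iff₀ (sub_pos.2 (hs1 n)), mul_comm]
    exact h _ (hs0 n) (hs1 n)
  have hlim1 : Tendsto (fun n => ENNReal.ofReal (1 / (1 - s n))) atTop (𝓝 1) := by
    have : Tendsto (fun n => 1 / (1 - s n)) atTop (𝓝 (1 / (1 - 0))) :=
      tendsto_const_nhds.div (hs.const_sub 1) (by norm_num)
    simpa using ENNReal.tendsto_ofReal this
  calc ∫⁻ x, (ENNReal.ofReal (1 - x))⁻¹ ∂κ
      = ∫⁻ x, liminf (fun n => (ENNReal.ofReal (1 + (s n - 1) * x))⁻¹) atTop ∂κ :=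
        lintegral_congr fun x => (hlim x).liminf_eq.symm
    _ ≤ liminf (fun n => ∫⁻ x, (ENNReal.ofReal (1 + (s n - 1) * x))⁻¹ ∂κ) atTop :=
        lintegral_liminf_le fun n => by fun_prop
    _ ≤ liminf (fun n => ENNReal.ofReal (1 / (1 - s n))) atTop :=
        liminf_le_liminf (Eventually.of_forall hle)
    _ = 1 := hlim1.liminf_eq

/-- With `p = 1 + (s - 1) x` and `q = 1 - x`, the identity `p + (s - 1) q = s` gives `1 / (p q) = 1
/ (s q) + (s - 1) / (s p)`. Hence `f` is represented by `(1 - x)⁻¹ κ` plus an atom at `1` of mass `d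
= 1 - ∫ (1 - x)⁻¹ dκ`, and `f ≥ 0` forces `d ≥ 0`. -/
theorem isStieltjesFun_of_mul_eq_one_add {f : ℝ → ℝ} (κ : Measure ℝ) [IsFiniteMeasure κ]
    (hκ : ∀ᵐ t ∂κ, t ∈ Icc (0 : ℝ) 1) (hnn : ∀ s : ℝ, 0 < s → 0 ≤ f s)
    (hf : ∀ s : ℝ, 0 < s → s * f s = 1 + (s - 1) * ∫ x, (1 + (s - 1) * x)⁻¹ ∂κ) :
    IsStieltjesFun f := by
  have hlint := lintegral_inv_one_sub_le hκ fun s hs _ => by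
    nlinarith [hf s hs, mul_nonneg hs.le (hnn s hs)]
  have hne : ∀ᵐ x ∂κ, x < 1 := by
    filter_upwards [ae_lt_top (by fun_prop) (hlint.trans_lt ENNReal.one_lt_top).ne] with x hx
    simpa using hx
  have heq : ∀ᵐ x ∂κ, (ENNReal.ofReal (1 - x))⁻¹ = ENNReal.ofReal (1 - x)⁻¹ :=
    hne.mono fun x hx => (ENNReal.ofReal_inv_of_pos (sub_pos.2 hx)).symm
  rw [lintegral_congr_ae heq] at hlint
  have hnn' : 0 ≤ᵐ[κ] fun x => (1 - x)⁻¹ := hne.mono fun x hx => inv_nonneg.2 (sub_pos.2 hx).le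
  have hint : Integrable (fun x : ℝ => (1 - x)⁻¹) κ :=
    ⟨by fun_prop, (hasFiniteIntegral_iff_ofReal hnn').2 (hlint.trans_lt ENNReal.one_lt_top)⟩
  have hd : ∫ x, (1 - x)⁻¹ ∂κ ≤ 1 := by
    rw [integral_eq_lintegral_of_nonneg_ae hnn' hint.1]
    exact ENNReal.toReal_le_of_le_ofReal zero_le_one (by simpa using hlint)
  let d : ℝ := 1 - ∫ x, (1 - x)⁻¹ ∂κ
  have hd0 : 0 ≤ d := sub_nonneg.2 hd
  let ρ : Measure ℝ := κ.withDensity fun x => ENNReal.ofReal (1 - x)⁻¹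
  have hρ : IsFiniteMeasure ρ := isFiniteMeasure_withDensity_ofReal hint.2
  have hfd : IsFiniteMeasure (ENNReal.ofReal d • Measure.dirac (1 : ℝ)) :=
    Measure.smul_finite _ ENNReal.ofReal_ne_top
  have h1 : ∀ᵐ t ∂(ENNReal.ofReal d • Measure.dirac (1 : ℝ)), t ∈ Icc (0 : ℝ) 1 :=
    Measure.ae_smul_measure ((ae_dirac_iff measurableSet_Icc).2 (by simp)) _
  have h2 : ∀ᵐ t ∂ρ, t ∈ Icc (0 : ℝ) 1 := (withDensity_absolutelyContinuous _ _).ae_le hκ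
  refine isStieltjesFun_of_measure_Icc (ENNReal.ofReal d • Measure.dirac 1 + ρ) ?_ fun s hs => ?_
  · rw [ae_add_measure_iff]
    exact ⟨h1, h2⟩
  · rw [integral_add_measure (integrable_inv_one_add_mul h1 hs) (integrable_inv_one_add_mul h2 hs),
      integral_smul_measure, integral_dirac,
      integral_withDensity_eq_integral_toReal_smul (by fun_prop) (by simp),
      ENNReal.toReal_ofReal hd0]
    have h3 : ∫ x, (ENNReal.ofReal (1 - x)⁻¹).toReal • (1 + (s - 1) * x)⁻¹ ∂κ =
        ∫ x, (s⁻¹ * (1 - x)⁻¹ + (s - 1) * s⁻¹ * (1 + (s - 1) * x)⁻¹) ∂κ := by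
      refine integral_congr_ae ?_
      filter_upwards [hκ, hne] with x hx hx1
      have hx2 := one_add_mul_pos hs hx
      have hx3 : 0 < 1 - x := sub_pos.2 hx1
      have hx4 : 1 + (s - 1) * x + (s - 1) * (1 - x) = s := by ring
      rw [ENNReal.toReal_ofReal (inv_nonneg.2 hx3.le), smul_eq_mul]
      generalize 1 + (s - 1) * x = p at *
      generalize 1 - x = q at *
      field_simp
      linarith
    rw [h3, integral_add (hint.const_mul _) ((integrable_inv_one_add_mul hκ hs).const_mul _),
      integral_const_mul, integral_const_mul]
    have h4 := hf s hs
    have h5 : f s = s⁻¹ * (1 + (s - 1) * ∫ x, (1 + (s - 1) * x)⁻¹ ∂κ) := by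
      rw [← h4]; field_simp
    rw [h5]
    simp only [d, smul_eq_mul]
    rw [show (1 + (s - 1) * (1 : ℝ)) = s by ring]
    ring

/-- If `f` is a non-zero Stieltjes function, so is `s ↦ 1 / (s f(s))`. -/
theorem IsStieltjesFun.inv_mul {f : ℝ → ℝ} (hf : IsStieltjesFun f)
    (hpos : ∀ s : ℝ, 0 < s → 0 < f s) : IsStieltjesFun (fun s => (s * f s)⁻¹) := by
  obtain ⟨μ, hfin, hμ, hrep⟩ := hf.exists_measure_Icc
  have hμ0 : NeZero μ := ⟨by
    rintro rfl
    have := hpos 1 one_pos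
    rw [hrep 1 one_pos] at this
    simp at this⟩
  have hm : 0 < μ.real univ := measureReal_univ_pos
  -- Normalised so that the constant `1` is a unit vector of `L²`.
  let μ' : Measure ℝ := (μ univ)⁻¹ • μ
  have hμ' : ∀ᵐ t ∂μ', t ∈ Icc (0 : ℝ) 1 := Measure.ae_smul_measure hμ _
  have hrep' : ∀ s : ℝ, 0 < s → ∫ t, (1 + (s - 1) * t)⁻¹ ∂μ' = (μ.real univ)⁻¹ * f s := by
    intro s hs
    rw [integral_smul_measure, ENNReal.toReal_inv, smul_eq_mul, hrep s hs]
    rfl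
  obtain ⟨κ, hκfin, hκ, hinv⟩ := exists_measure_inv_integral μ' hμ'
  have key : IsStieltjesFun (fun s => s⁻¹ * ((μ.real univ)⁻¹ * f s)⁻¹) := by
    refine isStieltjesFun_of_mul_eq_one_add κ hκ (fun s hs => ?_) fun s hs => ?_
    · have := hpos s hs
      positivity
    · have := hinv s hs (by rw [hrep' s hs]; have := hpos s hs; positivity)
      rw [← this, hrep' s hs, mul_inv_cancel_left₀ hs.ne']
  refine (key.const_mul (inv_nonneg.2 hm.le)).congr fun s hs => ?_
  field_simp

/-! ### From Stieltjes to complete Bernstein functions -/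

theorem iteratedDeriv_eq_of_hasDerivAt {G : ℕ → ℝ → ℝ}
    (hG : ∀ n s, 0 < s → HasDerivAt (G n) (G (n + 1) s) s) (n : ℕ) :
    ∀ s : ℝ, 0 < s → iteratedDeriv n (G 0) s = G n s := by
  induction n with
  | zero => intro s _; simp
  | succ n ih =>
    intro s hs
    rw [iteratedDeriv_succ, ← (hG n s hs).deriv]
    refine EventuallyEq.deriv_eq ?_
    filter_upwards [Ioi_mem_nhds hs] with x hx using ih x hx

theorem contDiffOn_of_hasDerivAt {G : ℕ → ℝ → ℝ}
    (hG : ∀ n s, 0 < s → HasDerivAt (G n) (G (n + 1) s) s) :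
    ContDiffOn ℝ ((⊤ : ℕ∞) : WithTop ℕ∞) (G 0) (Ioi 0) := by
  refine contDiffOn_of_differentiableOn_deriv fun m _ => ?_
  have h : EqOn (iteratedDerivWithin m (G 0) (Ioi 0)) (G m) (Ioi 0) := fun s hs =>
    (iteratedDerivWithin_of_isOpen isOpen_Ioi hs).trans (iteratedDeriv_eq_of_hasDerivAt hG m s hs)
  exact DifferentiableOn.congr
    (fun s hs => (hG m s hs).differentiableAt.differentiableWithinAt) h

/-- Since the derivatives decrease in absolute value, their value at `s / 2` is an integrable bound
on `(s / 2, ∞)`, a neighbourhood of `s`. -/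
theorem hasDerivAt_integral_of_antitone_abs {α : Type*} [MeasurableSpace α] {μ : Measure α}
    {F : ℕ → ℝ → α → ℝ}
    (hder : ∀ᵐ x ∂μ, ∀ n s, 0 < s → HasDerivAt (F n · x) (F (n + 1) s x) s)
    (hint : ∀ n s, 0 < s → Integrable (F n s) μ)
    (hmono : ∀ᵐ x ∂μ, ∀ n c s, 0 < c → c ≤ s → |F (n + 1) s x| ≤ |F (n + 1) c x|)
    (n : ℕ) (s : ℝ) (hs : 0 < s) :
    HasDerivAt (fun s => ∫ x, F n s x ∂μ) (∫ x, F (n + 1) s x ∂μ) s := by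
  have hs2 : 0 < s / 2 := half_pos hs
  refine (hasDerivAt_integral_of_dominated_loc_of_deriv_le (F := F n) (F' := F (n + 1))
    (Ioi_mem_nhds (half_lt_self hs)) ?_ (hint n s hs) (hint (n + 1) s hs).1 ?_
    (hint (n + 1) (s / 2) hs2).norm ?_).2
  · filter_upwards [Ioi_mem_nhds hs] with x hx using (hint n x hx).1
  · exact hmono.mono fun x hx c hc => hx n _ _ hs2 (le_of_lt hc)
  · exact hder.mono fun x hx c hc => hx n c (hs2.trans hc)

theorem pow_mul_exp_neg_le {u τ : ℝ} (hu : 0 ≤ u) (hτ : 0 < τ) (n : ℕ) :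
    u ^ n * Real.exp (-(u * τ)) ≤ n.factorial / τ ^ n := by
  have h := Real.pow_div_factorial_le_exp (u * τ) (by positivity) n
  rw [Real.exp_neg, ← div_eq_mul_inv, div_le_div_iff₀ (Real.exp_pos _) (by positivity), ← mul_pow]
  rwa [div_le_iff₀' (by positivity)] at h

/-- The density whose Laplace transform is `∫ (1 + (s - 1) x)⁻¹ dμ(x)`, for `μ` on `(0, 1]`. -/
noncomputable def laplaceDensity (μ : Measure ℝ) (t : ℝ) : ℝ :=
  ∫ x, x⁻¹ * Real.exp (-((x⁻¹ - 1) * t)) ∂μ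

theorem isCompletelyMonotoneFun_laplaceDensity {μ : Measure ℝ} [IsFiniteMeasure μ]
    (hμ : ∀ᵐ x ∂μ, x ∈ Ioc (0 : ℝ) 1) : IsCompletelyMonotoneFun (laplaceDensity μ) := by
  let F : ℕ → ℝ → ℝ → ℝ := fun n t x => x⁻¹ * ((-(x⁻¹ - 1)) ^ n * Real.exp (-((x⁻¹ - 1) * t)))
  have hu : ∀ {x : ℝ}, x ∈ Ioc (0 : ℝ) 1 → 0 ≤ x⁻¹ - 1 := fun hx =>
    sub_nonneg.2 ((one_le_inv₀ hx.1).2 hx.2)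
  have habs : ∀ n t {x : ℝ}, x ∈ Ioc (0 : ℝ) 1 →
      |F n t x| = x⁻¹ * ((x⁻¹ - 1) ^ n * Real.exp (-((x⁻¹ - 1) * t))) := by
    intro n t x hx
    simp only [F]
    rw [abs_mul, abs_mul, abs_pow, abs_neg, abs_of_nonneg (hu hx), Real.abs_exp,
      abs_of_pos (inv_pos.2 hx.1)]
  have hder : ∀ᵐ x ∂μ, ∀ n t, 0 < t → HasDerivAt (F n · x) (F (n + 1) t x) t := by
    refine Eventually.of_forall fun x n t _ => ?_
    have h := ((((hasDerivAt_id t).const_mul (x⁻¹ - 1)).neg.exp).const_mul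
      ((-(x⁻¹ - 1)) ^ n)).const_mul x⁻¹
    refine h.congr_deriv ?_
    simp only [F, id, pow_succ, Pi.neg_apply]
    ring
  have hint : ∀ n t, 0 < t → Integrable (F n t) μ := by
    intro n t ht
    -- The factor `x⁻¹` is unbounded near `0`; writing it as `(x⁻¹ - 1) + 1` leaves the powers `n +
    -- 1` and `n`, both controlled by the exponential.
    refine Integrable.of_bound (by fun_prop) ((n + 1).factorial / t ^ (n + 1) + n.factorial / t ^ n)
      (hμ.mono fun x hx => ?_)
    rw [Real.norm_eq_abs, habs n t hx]
    have h1 := pow_mul_exp_neg_le (hu hx) ht n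
    have h2 := pow_mul_exp_neg_le (hu hx) ht (n + 1)
    rw [pow_succ] at h2
    linarith
  have hmono : ∀ᵐ x ∂μ, ∀ n c s, 0 < c → c ≤ s → |F (n + 1) s x| ≤ |F (n + 1) c x| := by
    refine hμ.mono fun x hx n c s _ hcs => ?_
    have h0 := hu hx
    have h1 := hx.1
    rw [habs _ _ hx, habs _ _ hx]
    gcongr
  have hG := hasDerivAt_integral_of_antitone_abs hder hint hmono
  have hG0 : laplaceDensity μ = fun t => ∫ x, F 0 t x ∂μ := by
    ext t
    simp [laplaceDensity, F]
  rw [hG0]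
  refine ⟨contDiffOn_of_hasDerivAt (G := fun n t => ∫ x, F n t x ∂μ) hG, fun n t ht => ?_⟩
  rw [iteratedDeriv_eq_of_hasDerivAt (G := fun n t => ∫ x, F n t x ∂μ) hG n t ht,
    ← integral_const_mul]
  refine integral_nonneg_of_ae (hμ.mono fun x hx => ?_)
  have h0 := hu hx
  have h1 := hx.1
  simp only [F]
  rw [neg_pow (x⁻¹ - 1)]
  have h2 : (-1 : ℝ) ^ n * (-1) ^ n = 1 := by rw [← mul_pow]; simp
  have h3 : (-1 : ℝ) ^ n * (x⁻¹ * ((-1) ^ n * (x⁻¹ - 1) ^ n * Real.exp (-((x⁻¹ - 1) * t)))) =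
      ((-1 : ℝ) ^ n * (-1) ^ n) * (x⁻¹ * ((x⁻¹ - 1) ^ n * Real.exp (-((x⁻¹ - 1) * t)))) := by ring
  rw [h3, h2]
  simp only [Pi.zero_apply]
  positivity

/-- Fubini: the inner integral `∫₀^∞ x⁻¹ e^{-(s + x⁻¹ - 1) t} dt` equals `(1 + (s - 1) x)⁻¹`. The
integrand is positive, so integrability of this kernel in `x` gives joint integrability. -/
theorem laplace_laplaceDensity {μ : Measure ℝ} [IsFiniteMeasure μ]
    (hμ : ∀ᵐ x ∂μ, x ∈ Ioc (0 : ℝ) 1) {s : ℝ} (hs : 0 < s) :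
    IntegrableOn (fun t => Real.exp (-(s * t)) * laplaceDensity μ t) (Ioi 0) volume ∧
      ∫ t in Ioi (0 : ℝ), Real.exp (-(s * t)) * laplaceDensity μ t =
        ∫ x, (1 + (s - 1) * x)⁻¹ ∂μ := by
  let K : ℝ → ℝ → ℝ := fun t x => Real.exp (-(s * t)) * (x⁻¹ * Real.exp (-((x⁻¹ - 1) * t)))
  have hK : ∀ t, ∫ x, K t x ∂μ = Real.exp (-(s * t)) * laplaceDensity μ t := fun t =>
    integral_const_mul _ _
  have hKexp : ∀ x, (fun t => K t x) = fun t => x⁻¹ * Real.exp (-(s + (x⁻¹ - 1)) * t) := by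
    intro x
    ext t
    simp only [K]
    rw [mul_left_comm, ← Real.exp_add]
    ring_nf
  have hneg : ∀ {x : ℝ}, x ∈ Ioc (0 : ℝ) 1 → -(s + (x⁻¹ - 1)) < 0 := fun hx => by
    have := (one_le_inv₀ hx.1).2 hx.2
    linarith
  have hKi : ∀ {x : ℝ}, x ∈ Ioc (0 : ℝ) 1 → IntegrableOn (fun t => K t x) (Ioi 0) volume := by
    intro x hx
    rw [hKexp]
    exact (integrableOn_exp_mul_Ioi (hneg hx) 0).const_mul _
  have hKv : ∀ {x : ℝ}, x ∈ Ioc (0 : ℝ) 1 →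
      ∫ t in Ioi (0 : ℝ), K t x = (1 + (s - 1) * x)⁻¹ := by
    intro x hx
    rw [hKexp, integral_const_mul, integral_exp_mul_Ioi (hneg hx)]
    have h1 := hx.1
    have h2 : -(s + (x⁻¹ - 1)) = -((1 + (s - 1) * x) / x) := by field_simp; ring
    rw [h2, mul_zero, Real.exp_zero, neg_div_neg_eq]
    field_simp
  have hmeas : AEStronglyMeasurable (Function.uncurry K)
      ((volume.restrict (Ioi 0)).prod μ) := by
    refine Measurable.aestronglyMeasurable ?_
    simp only [K, Function.uncurry_def]
    fun_prop
  have hprod : Integrable (Function.uncurry K) ((volume.restrict (Ioi 0)).prod μ) := by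
    rw [integrable_prod_iff' hmeas]
    refine ⟨hμ.mono fun x hx => hKi hx, ?_⟩
    refine (integrable_inv_one_add_mul (hμ.mono fun x hx => Ioc_subset_Icc_self hx) hs).congr
      (hμ.mono fun x hx => ?_)
    refine (hKv hx).symm.trans (integral_congr_ae (Eventually.of_forall fun t => ?_))
    have h1 := hx.1
    simp only [Function.uncurry_apply_pair, K]
    rw [Real.norm_of_nonneg (by positivity)]
  refine ⟨?_, ?_⟩
  · have := hprod.integral_prod_left
    rw [IntegrableOn]
    simpa only [Function.uncurry_apply_pair, hK] using this
  · simp only [← hK]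
    rw [integral_integral_swap hprod]
    exact integral_congr_ae (hμ.mono fun x hx => hKv hx)

/-- The first `s`-derivative of `s (1 + (s - 1) t)⁻¹` is `(1 - t) (1 + (s - 1) t)⁻² ≥ 0`, and each
further one brings down a negative multiple of `t (1 + (s - 1) t)⁻¹`, so the signs alternate. -/
theorem isBernsteinFun_mul_integral {μ : Measure ℝ} [IsFiniteMeasure μ]
    (hμ : ∀ᵐ t ∂μ, t ∈ Icc (0 : ℝ) 1) :
    IsBernsteinFun (fun s => ∫ t, s * (1 + (s - 1) * t)⁻¹ ∂μ) := by
  let F : ℕ → ℝ → ℝ → ℝ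
    | 0 => fun s t => s * (1 + (s - 1) * t)⁻¹
    | n + 1 => fun s t => (-1) ^ n * ((n + 1).factorial * ((1 - t) * t ^ n) *
        (1 + (s - 1) * t)⁻¹ ^ (n + 2))
  have hk : ∀ s t : ℝ, 0 < s → t ∈ Icc (0 : ℝ) 1 →
      HasDerivAt (fun s => (1 + (s - 1) * t)⁻¹) (-t * (1 + (s - 1) * t)⁻¹ ^ 2) s := by
    intro s t hs ht
    have h1 : HasDerivAt (fun s : ℝ => 1 + (s - 1) * t) t s := by
      simpa using (((hasDerivAt_id s).sub_const 1).mul_const t).const_add 1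
    refine (h1.inv (one_add_mul_pos hs ht).ne').congr_deriv ?_
    rw [inv_pow, div_eq_mul_inv]
  have hder : ∀ᵐ t ∂μ, ∀ n s, 0 < s → HasDerivAt (F n · t) (F (n + 1) s t) s := by
    refine hμ.mono fun t ht n s hs => ?_
    have hne := (one_add_mul_pos hs ht).ne'
    cases n with
    | zero =>
      refine ((hasDerivAt_id s).mul (hk s t hs ht)).congr_deriv ?_
      have hinv := mul_inv_cancel₀ hne
      simp only [F, id, pow_zero, zero_add, Nat.factorial_one, Nat.cast_one]
      generalize (1 + (s - 1) * t)⁻¹ = p at *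
      linear_combination -p * hinv
    | succ n =>
      refine ((((hk s t hs ht).pow (n + 2)).const_mul _).const_mul _).congr_deriv ?_
      simp only [F]
      rw [Nat.factorial_succ (n + 1)]
      push_cast
      ring
  have habs : ∀ n s t, 0 < s → t ∈ Icc (0 : ℝ) 1 → |F (n + 1) s t| =
      (n + 1).factorial * ((1 - t) * t ^ n) * (1 + (s - 1) * t)⁻¹ ^ (n + 2) := by
    intro n s t hs ht
    have h1 := one_add_mul_pos hs ht
    have h2 := ht.1
    have h3 := sub_nonneg.2 ht.2
    simp only [F]
    rw [abs_mul, abs_pow, abs_neg, abs_one, one_pow, one_mul, abs_of_nonneg (by positivity)]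
  have hint : ∀ n s, 0 < s → Integrable (F n s) μ := by
    intro n s hs
    cases n with
    | zero => exact (integrable_inv_one_add_mul hμ hs).const_mul s
    | succ n =>
      refine Integrable.of_bound (by simp only [F]; fun_prop)
        ((n + 1).factorial * (1 * 1) * (min 1 s)⁻¹ ^ (n + 2)) (hμ.mono fun t ht => ?_)
      rw [Real.norm_eq_abs, habs n s t hs ht]
      have h1 := inv_one_add_mul_le hs ht
      have h2 := one_add_mul_pos hs ht
      have h3 := sub_nonneg.2 ht.2
      have h4 := ht.1
      have h5 : 1 - t ≤ 1 := by linarith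
      have h6 : t ^ n ≤ 1 := pow_le_one₀ ht.1 ht.2
      gcongr
  have hmono : ∀ᵐ t ∂μ, ∀ n c s, 0 < c → c ≤ s → |F (n + 1) s t| ≤ |F (n + 1) c t| := by
    refine hμ.mono fun t ht n c s hc hcs => ?_
    have h1 := one_add_mul_pos hc ht
    have h2 := one_add_mul_pos (hc.trans_le hcs) ht
    have h3 := sub_nonneg.2 ht.2
    have h4 := ht.1
    rw [habs n s t (hc.trans_le hcs) ht, habs n c t hc ht]
    gcongr
  have hG := hasDerivAt_integral_of_antitone_abs hder hint hmono
  refine ⟨fun s hs => ?_, contDiffOn_of_hasDerivAt (G := fun n s => ∫ t, F n s t ∂μ) hG,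
    fun n s hs => ?_⟩
  · refine integral_nonneg_of_ae (hμ.mono fun t ht => ?_)
    have := one_add_mul_pos hs ht
    simp only [Pi.zero_apply]
    positivity
  · have h := iteratedDeriv_eq_of_hasDerivAt (G := fun n s => ∫ t, F n s t ∂μ) hG (n + 1) s hs
    rw [show iteratedDeriv (n + 1) (fun s => ∫ t, s * (1 + (s - 1) * t)⁻¹ ∂μ) s =
      ∫ t, F (n + 1) s t ∂μ from h, ← integral_const_mul]
    refine integral_nonneg_of_ae (hμ.mono fun t ht => ?_)
    have h1 := one_add_mul_pos hs ht
    have h2 := sub_nonneg.2 ht.2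
    have h3 := ht.1
    simp only [F, Pi.zero_apply]
    rw [← mul_assoc, ← mul_pow, neg_one_mul, neg_neg, one_pow, one_mul]
    positivity

theorem IsBernsteinFun.congr {f g : ℝ → ℝ} (hf : IsBernsteinFun f)
    (h : ∀ s : ℝ, 0 < s → g s = f s) : IsBernsteinFun g := by
  obtain ⟨h0, h1, h2⟩ := hf
  refine ⟨fun s hs => (h s hs).symm ▸ h0 s hs, h1.congr fun s hs => h s hs, fun n s hs => ?_⟩
  have : g =ᶠ[𝓝 s] f := by filter_upwards [Ioi_mem_nhds hs] with x hx using h x hx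
  rw [this.iteratedDeriv_eq]
  exact h2 n s hs

/-- If `f` is a Stieltjes function, then `s ↦ s f(s)` is a complete Bernstein function. -/
theorem IsStieltjesFun.isCompleteBernsteinFun {f h : ℝ → ℝ} (hf : IsStieltjesFun f)
    (hh : ∀ s : ℝ, 0 < s → h s = s * f s) : IsCompleteBernsteinFun h := by
  obtain ⟨μ, hfin, hμ, hrep⟩ := hf.exists_measure_Icc
  -- The atom at `0` has a constant kernel, which is no Laplace transform of a function; it becomes
  -- the drift.
  have hμ' : ∀ᵐ x ∂(μ.restrict (Ioc 0 1)), x ∈ Ioc (0 : ℝ) 1 := ae_restrict_mem measurableSet_Ioc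
  refine ⟨(isBernsteinFun_mul_integral hμ).congr fun s hs => ?_, μ.real {0}, measureReal_nonneg,
    laplaceDensity (μ.restrict (Ioc 0 1)), isCompletelyMonotoneFun_laplaceDensity hμ',
    fun s hs => ⟨(laplace_laplaceDensity hμ' hs).1, ?_⟩⟩
  · rw [hh s hs, hrep s hs, integral_const_mul]
  · have hi := integrable_inv_one_add_mul hμ hs
    rw [(laplace_laplaceDensity hμ' hs).2, hh s hs, mul_div_cancel_left₀ _ hs.ne', hrep s hs]
    conv_lhs => rw [← Measure.restrict_eq_self_of_ae_mem hμ, ← Ioc_insert_left zero_le_one,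
      insert_eq]
    rw [setIntegral_union (by simp) measurableSet_Ioc hi.integrableOn hi.integrableOn,
      integral_singleton]
    simp

/-! ### Range of `φ` and behaviour at `0+` -/

theorem integral_inv_one_add_mul_anti {μ : Measure ℝ} [IsFiniteMeasure μ]
    (hμ : ∀ᵐ t ∂μ, t ∈ Icc (0 : ℝ) 1) {c s : ℝ} (hc : 0 < c) (hcs : c ≤ s) :
    ∫ t, (1 + (s - 1) * t)⁻¹ ∂μ ≤ ∫ t, (1 + (c - 1) * t)⁻¹ ∂μ := by
  refine integral_mono_ae (integrable_inv_one_add_mul hμ (hc.trans_le hcs))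
    (integrable_inv_one_add_mul hμ hc) (hμ.mono fun t ht => ?_)
  have h1 := one_add_mul_pos hc ht
  have h2 := ht.1
  simp only
  gcongr

/-- A Stieltjes function with limit `1` at `0+` which is not identically `1` takes values in
`(0, 1)`. -/
theorem IsStieltjesFun.mem_Ioo_of_tendsto_one {φ : ℝ → ℝ} (hφ : IsStieltjesFun φ)
    (hφ0 : Tendsto φ (𝓝[>] 0) (𝓝 1)) (hne : ∃ s : ℝ, 0 < s ∧ φ s ≠ 1) {s : ℝ} (hs : 0 < s) :
    0 < φ s ∧ φ s < 1 := by
  obtain ⟨μ, hfin, hμ, hrep⟩ := hφ.exists_measure_Icc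
  have hanti : ∀ {c s : ℝ}, 0 < c → c ≤ s → φ s ≤ φ c := fun hc hcs => by
    rw [hrep _ hc, hrep _ (hc.trans_le hcs)]
    exact integral_inv_one_add_mul_anti hμ hc hcs
  have hle : ∀ {s : ℝ}, 0 < s → φ s ≤ 1 := fun {s} hs => by
    refine ge_of_tendsto hφ0 ?_
    filter_upwards [Ioc_mem_nhdsGT hs] with c hc using hanti hc.1 hc.2
  have hknn : ∀ {s : ℝ}, 0 < s → 0 ≤ᵐ[μ] fun t => (1 + (s - 1) * t)⁻¹ := fun hs =>
    hμ.mono fun t ht => inv_nonneg.2 (one_add_mul_pos hs ht).le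
  constructor
  · refine lt_of_le_of_ne ?_ fun h0 => ?_
    · rw [hrep s hs]
      exact integral_nonneg_of_ae (hknn hs)
    · rw [hrep s hs, eq_comm, integral_eq_zero_iff_of_nonneg_ae (hknn hs)
        (integrable_inv_one_add_mul hμ hs)] at h0
      -- The kernel is strictly positive, so a zero of `φ` forces `μ = 0` and `φ` vanishes on `(0,
      -- ∞)`, against the limit `1`.
      have hbot : ∀ᵐ t ∂μ, False := by
        filter_upwards [h0, hμ] with t h1 h2
        exact (inv_pos.2 (one_add_mul_pos hs h2)).ne' h1
      have hμ0 : μ = 0 := by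
        rw [← ae_eq_bot]
        exact eventually_false_iff_eq_bot.1 hbot
      have : Tendsto φ (𝓝[>] 0) (𝓝 0) := by
        refine tendsto_const_nhds.congr' ?_
        filter_upwards [self_mem_nhdsWithin] with c hc
        rw [hrep c hc, hμ0, integral_zero_measure]
      exact zero_ne_one (tendsto_nhds_unique this hφ0)
  · refine lt_of_le_of_ne (hle hs) fun h1 => ?_
    have hs2 := half_pos hs
    -- If `φ` takes the value `1` at `s`, it does so at `s / 2`. The kernel is strictly decreasing
    -- in `s` unless `t = 0`, so `μ` sits at `0` and `φ` is constant.
    have h2 : φ (s / 2) = 1 := le_antisymm (hle hs2) (h1 ▸ hanti hs2 (half_lt_self hs).le)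
    have hi := integrable_inv_one_add_mul hμ hs
    have hi2 := integrable_inv_one_add_mul hμ hs2
    have h3 : ∫ t, ((1 + (s / 2 - 1) * t)⁻¹ - (1 + (s - 1) * t)⁻¹) ∂μ = 0 := by
      rw [integral_sub hi2 hi, ← hrep s hs, ← hrep _ hs2, h1, h2, sub_self]
    have hnn : 0 ≤ᵐ[μ] fun t => (1 + (s / 2 - 1) * t)⁻¹ - (1 + (s - 1) * t)⁻¹ := by
      refine hμ.mono fun t ht => ?_
      have h5 := one_add_mul_pos hs2 ht
      have h6 := ht.1
      simp only [Pi.zero_apply, sub_nonneg]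
      gcongr
      linarith
    have h4 : ∀ᵐ t ∂μ, t = 0 := by
      filter_upwards [(integral_eq_zero_iff_of_nonneg_ae hnn (hi2.sub hi)).1 h3] with t h5
      have h6 := inv_injective (sub_eq_zero.1 h5)
      have h7 : s * t = 0 := by linarith
      exact (mul_eq_zero.1 h7).resolve_left hs.ne'
    obtain ⟨c, hc, hcne⟩ := hne
    refine hcne ?_
    rw [← h1, hrep c hc, hrep s hs]
    exact integral_congr_ae (h4.mono fun t ht => by simp [ht])

/-- Dominated convergence, with `s / (s + u) ≤ 1 / (1 + u)` for `0 < s ≤ 1`. This recovers the pole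
coefficient `a` from `f`. -/
theorem tendsto_mul_stieltjes {f : ℝ → ℝ} {a b : ℝ} {σ : Measure ℝ}
    (hσ : IntegrableOn (fun u : ℝ => 1 / (1 + u)) (Ioi 0) σ)
    (hf : ∀ s : ℝ, 0 < s → f s = a / s + b + ∫ u in Ioi (0 : ℝ), 1 / (s + u) ∂σ) :
    Tendsto (fun s => s * f s) (𝓝[>] 0) (𝓝 a) := by
  have hid : Tendsto (fun s : ℝ => s) (𝓝[>] 0) (𝓝 0) := tendsto_id.mono_left nhdsWithin_le_nhds
  have hI : Tendsto (fun s : ℝ => ∫ u in Ioi (0 : ℝ), s * (1 / (s + u)) ∂σ) (𝓝[>] 0)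
      (𝓝 (∫ _ in Ioi (0 : ℝ), (0 : ℝ) ∂σ)) := by
    refine tendsto_integral_filter_of_dominated_convergence _
      (Eventually.of_forall fun s => Measurable.aestronglyMeasurable (by fun_prop)) ?_ hσ ?_
    · filter_upwards [Ioc_mem_nhdsGT (zero_lt_one (α := ℝ))] with s hs
      filter_upwards [ae_restrict_mem measurableSet_Ioi] with u hu
      have hu0 : 0 < u := hu
      have hs0 := hs.1
      rw [Real.norm_of_nonneg (by positivity), mul_one_div,
        div_le_div_iff₀ (by positivity) (by positivity)]
      nlinarith [hs.2]
    · filter_upwards [ae_restrict_mem measurableSet_Ioi] with u hu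
      have hu0 : 0 < u := hu
      have h : Tendsto (fun s : ℝ => 1 / (s + u)) (𝓝[>] 0) (𝓝 (1 / (0 + u))) :=
        tendsto_const_nhds.div (hid.add_const u) (by simpa using hu0.ne')
      simpa using hid.mul h
  have hlim := ((hid.const_mul b).const_add a).add hI
  simp only [mul_zero, integral_zero, add_zero] at hlim
  refine hlim.congr' ?_
  filter_upwards [self_mem_nhdsWithin] with s hs
  have hs0 : (s : ℝ) ≠ 0 := (mem_Ioi.1 hs).ne'
  rw [hf s hs, integral_const_mul]
  field_simp

/-- Subtracting the part of the mass at `0` which is visible in the limit at `0+`. -/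
theorem IsStieltjesFun.sub_div {f : ℝ → ℝ} (hf : IsStieltjesFun f) {c : ℝ}
    (h : Tendsto (fun s => s * f s) (𝓝[>] 0) (𝓝 c)) : IsStieltjesFun (fun s => f s - c / s) := by
  obtain ⟨a, b, ha, hb, σ, hσ, hrep⟩ := hf
  obtain rfl := tendsto_nhds_unique h (tendsto_mul_stieltjes hσ hrep)
  exact ⟨0, b, le_rfl, hb, σ, hσ, fun s hs => by simp only; rw [hrep s hs]; ring⟩

/-! ### The main theorem -/

theorem mainTheorem3 (B : ℝ) (hB : 0 < B) (φ : ℝ → ℝ)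
    (hφ : IsStieltjesFun φ)
    (hbdd : ∃ C : ℝ, ∀ s : ℝ, 0 < s → φ s ≤ C)
    (hφ0 : Filter.Tendsto φ (nhdsWithin 0 (Set.Ioi 0)) (nhds 1))
    (hne : ∃ s : ℝ, 0 < s ∧ φ s ≠ 1) :
    (∀ s : ℝ, 0 < s → 0 < φ s ∧ φ s < 1) ∧
    (∀ s : ℝ, 0 < s → laplaceExponent B φ s * memoryM B φ s = 1) ∧
    IsCompleteBernsteinFun (laplaceExponent B φ) ∧
    (∀ s : ℝ, 0 < s → memoryK B φ s = B * (1 - φ s) / (s * φ s)) ∧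
    IsStieltjesFun (memoryK B φ) ∧
    (∀ s : ℝ, 0 < s → memoryK B φ s * memoryM B φ s = 1 / s) ∧
    IsCompleteBernsteinFun (fun s : ℝ => s / laplaceExponent B φ s) := by
  have h01 : ∀ s : ℝ, 0 < s → 0 < φ s ∧ φ s < 1 := fun s hs =>
    hφ.mem_Ioo_of_tendsto_one hφ0 hne hs
  have hΨ : ∀ s : ℝ, 0 < s → 0 < laplaceExponent B φ s := fun s hs =>
    div_pos (mul_pos hB (sub_pos.2 (h01 s hs).2)) (h01 s hs).1
  -- The pole coefficient of `1 / (s φ)` is `1`, so subtracting `1 / s` removes the pole exactly.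
  have hlim : Tendsto (fun s => s * (s * φ s)⁻¹) (𝓝[>] 0) (𝓝 1) := by
    have h := hφ0.inv₀ one_ne_zero
    rw [inv_one] at h
    refine h.congr' ?_
    filter_upwards [self_mem_nhdsWithin] with s hs
    rw [mul_inv, mul_inv_cancel_left₀ (mem_Ioi.1 hs).ne']
  have hK : IsStieltjesFun (memoryK B φ) := by
    refine (((hφ.inv_mul fun s hs => (h01 s hs).1).sub_div hlim).const_mul hB.le).congr
      fun s hs => ?_
    have := (h01 s hs).1
    simp only [memoryK, laplaceExponent]
    field_simp
  have hΨM : ∀ s : ℝ, 0 < s → laplaceExponent B φ s * memoryM B φ s = 1 := fun s hs => by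
    have h1 := (h01 s hs).1
    have h2 := sub_pos.2 (h01 s hs).2
    simp only [laplaceExponent, memoryM]
    field_simp
  refine ⟨h01, hΨM, hK.isCompleteBernsteinFun fun s hs => ?_, fun s hs => ?_, hK, fun s hs => ?_,
    (hK.inv_mul fun s hs => div_pos (hΨ s hs) hs).isCompleteBernsteinFun fun s hs => ?_⟩
  · rw [memoryK, mul_div_cancel₀ _ hs.ne']
  · rw [memoryK, laplaceExponent, div_div, mul_comm s]
  · rw [memoryK, div_mul_eq_mul_div, hΨM s hs]
  · have := hΨ s hs
    rw [memoryK]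
    field_simp
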